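/- Let $n\ge 2$, $\sigma>0$, and let $\mathcal C\subset\mathbb R^n$ be a nonempty finite set of $M$ vectors (codewords). A codeword $s$ is chosen with probability $1/M$ and sent over the AWGN channel: $y=s+z$, where the coordinates of $z$ are independent $N(0,\sigma^2)$ variables. Let $\Pr\{E\}=\frac1M\sum_{s\in\mathcal C}\Pr\{E\mid s\}$ be the error probability of maximum-likelihood decoding (ties broken arbitrarily). For $\delta>0$ let $A_\delta=\frac1M\sum_{s\in\mathcal C}\#\{t\in\mathcal C:\|s-t\|=\delta\}$ (the Euclidean distance spectrum), and let $$g(r)=\frac{2r^{n-1}e^{-r^2/(2\sigma^2)}}{2^{n/2}\sigma^n\Gamma(n/2)}\quad(r\ge 0),\qquad g(r)=0\quad(r<0),$$ $$p_2(r,\delta)=\begin{cases}\dfrac{\Gamma(n/2)}{\sqrt\pi\,\Gamma((n-1)/2)}\displaystyle\int_0^{\arccos(\delta/(2r))}\sin^{n-2}\varphi\,d\varphi,& r>\delta/2,\\[2mm]0,& r\le\delta/2,\end{cases}$$ and $f_u(r)=\sum_{\delta}A_\delta\,p_2(r,\delta)$, where the sum is over the finitely many distances $\delta>0$ between distinct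 codewords. Then $$\Pr\{E\}\le\int_0^\infty\min\{f_u(r),1\}\,g(r)\,dr,$$ and the integral converges. Here, for each codeword $s$, $g$ is the probability density of $\|y-s\|$ when $s$ is sent; and for distinct codewords $s,t$ and $r>0$, $p_2(r,\|s-t\|)$ is the fraction of the surface of the sphere $\{y:\|y-s\|=r\}$ formed by the spherical cap of points $y$ with $\|y-t\|\le\|y-s\|$. For given $n$ and $\sigma$ the bound depends only on the Euclidean distance spectrum: two nonempty finite codes in $\mathbb R^n$ with the same numbers $A_\delta$ $(\delta>0)$ have the same bound. -/

import Mathlib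

open MeasureTheory ProbabilityTheory
open scoped NNReal

namespace SphereBound

/-- Euclidean `n`-space. -/
abbrev Vec (n : ℕ) : Type := EuclideanSpace ℝ (Fin n)

noncomputable section

/-! ### The channel and maximum-likelihood decoding -/

/-- Law of the noise vector: independent centred Gaussian coordinates of variance `σ ^ 2`. -/
def noiseLaw (n : ℕ) (σ : ℝ≥0) : Measure (Vec n) :=
  (Measure.pi fun _ : Fin n => gaussianReal 0 (σ ^ 2)).map (WithLp.toLp 2)

/-- Law of the received vector `y = s + z` when `s` is transmitted over the AWGN channel. -/
def receivedLaw {n : ℕ} (σ : ℝ≥0) (s : Vec n) : Measure (Vec n) :=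
  (noiseLaw n σ).map fun z => s + z

/-- Channel likelihood: the density of the received vector at `y` when `s` is transmitted. -/
def likelihood {n : ℕ} (σ : ℝ≥0) (s y : Vec n) : ℝ :=
  ∏ i, gaussianPDFReal (s i) (σ ^ 2) (y i)

/-- `dec` is a maximum-likelihood decoder for the code `C` (ties are broken arbitrarily). -/
def IsMLDecoder {n : ℕ} (σ : ℝ≥0) (C : Finset (Vec n)) (dec : Vec n → Vec n) : Prop :=
  ∀ y, dec y ∈ C ∧ ∀ t ∈ C, likelihood σ t y ≤ likelihood σ (dec y) y

/-- Conditional decoding error probability `Pr{E | s}`. -/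
def condErrorProb {n : ℕ} (σ : ℝ≥0) (dec : Vec n → Vec n) (s : Vec n) : ℝ :=
  (receivedLaw σ s).real {y | dec y ≠ s}

/-- Decoding error probability `Pr{E}` for equiprobable codewords. -/
def errorProb {n : ℕ} (σ : ℝ≥0) (C : Finset (Vec n)) (dec : Vec n → Vec n) : ℝ :=
  ∑ s ∈ C, (1 / (C.card : ℝ)) * condErrorProb σ dec s

/-! ### The Euclidean distance spectrum -/

open Classical in
/-- `A_{δ|s}`: the number of codewords at Euclidean distance `δ` from `s`. -/
def condSpectrum {n : ℕ} (C : Finset (Vec n)) (s : Vec n) (δ : ℝ) : ℕ :=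
  (C.filter fun t => dist s t = δ).card

/-- `A_δ`: the average of `A_{δ|s}` over the equiprobable codewords `s`. -/
def spectrum {n : ℕ} (C : Finset (Vec n)) (δ : ℝ) : ℝ :=
  ∑ s ∈ C, (1 / (C.card : ℝ)) * (condSpectrum C s δ : ℝ)

open Classical in
/-- The (positive) distances between distinct codewords. -/
def distances {n : ℕ} (C : Finset (Vec n)) : Finset ℝ :=
  C.offDiag.image fun p => dist p.1 p.2

/-! ### The ingredients of the sphere bound -/

/-- The chi-type density `g`, extended by `0` to negative arguments. -/
def radialDensity (n : ℕ) (σ : ℝ≥0) (r : ℝ) : ℝ :=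
  if 0 ≤ r then
    2 * r ^ (n - 1) * Real.exp (-r ^ 2 / (2 * (σ : ℝ) ^ 2)) /
      ((2 : ℝ) ^ ((n : ℝ) / 2) * (σ : ℝ) ^ n * Real.Gamma ((n : ℝ) / 2))
  else 0

/-- The term `p₂(r, δ)`. -/
def pairError (n : ℕ) (r δ : ℝ) : ℝ :=
  if δ / 2 < r then
    Real.Gamma ((n : ℝ) / 2) / (√Real.pi * Real.Gamma (((n : ℝ) - 1) / 2)) *
      ∫ φ in (0 : ℝ)..Real.arccos (δ / (2 * r)), Real.sin φ ^ (n - 2)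
  else 0

/-- The fraction of the surface of the sphere of radius `r` about `s` whose points `y` are
at least as close to `t` as to `s`. -/
def sphereFraction {n : ℕ} (s t : Vec n) (r : ℝ) : ℝ :=
  (volume : Measure (Vec n)).toSphere.real
      {u | ‖(s + r • (u : Vec n)) - t‖ ≤ ‖(s + r • (u : Vec n)) - s‖} /
    (volume : Measure (Vec n)).toSphere.real Set.univ

/-- The averaged conditional union bound `f_u(r) = ∑_δ A_δ p₂(r, δ)`. -/
def unionBound {n : ℕ} (C : Finset (Vec n)) (r : ℝ) : ℝ :=
  ∑ δ ∈ distances C, spectrum C δ * pairError n r δ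

/-- The sphere bound `∫₀^∞ min {f_u(r), 1} g(r) dr`. -/
def sphereBound {n : ℕ} (σ : ℝ≥0) (C : Finset (Vec n)) : ℝ :=
  ∫ r in Set.Ioi (0 : ℝ), min (unionBound C r) 1 * radialDensity n σ r

end

end SphereBound

/-!
The decoder can only fail, when `s` is sent, if some codeword `t ≠ s` is at least as close to the
received vector as `s` (`norm_sub_le_of_likelihood_le`). The noise density depends on the norm only,
so in polar coordinates the norm of the noise has density `g` and its direction is independent of
the norm and uniform on the unit sphere (`lintegral_noiseLaw`). Given the norm `r`, the directions
that bring the received vector at least as close to `t` as to `s` form a spherical cap, whose share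
of the sphere is `p₂(r, ‖s - t‖)`. Hence the conditional error probability given `s` and `r` is at
most the minimum of one and the sum of these shares (`condErrorProb_le`). Averaging over the
codewords, concavity of `x ↦ min x 1` allows the average to be taken inside the minimum, and
grouping pairs of codewords by distance turns the averaged sum into `f_u(r)`
(`unionBound_eq_average`).

The area of a cap (`toSphere_cap`) is obtained by comparing the volume of a conical sector of the
unit ball in two ways. Polar coordinates express it as a multiple of the area of the cap. On the
other hand, after a rotation of the axis to the first coordinate axis, polar coordinates in the
orthogonal complement of the axis and planar polar coordinates in the half-plane of axial coordinate
and distance to the axis give the same multiple of the integral of `sin ^ (n - 2)`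
(`lintegral_axial`).

The spectrum determines the set of distances as its support, hence determines the bound.
-/

namespace SphereBound

open Measure Metric

/-! ### The noise law in polar coordinates -/

/-- Tonelli's theorem for a product of functions of separate coordinates. -/
theorem lintegral_pi_prod_eq_prod {n : ℕ} {f : Fin n → ℝ → ENNReal} (hf : ∀ i, Measurable (f i)) :
    ∫⁻ x : Fin n → ℝ, ∏ i, f i (x i) = ∏ i, ∫⁻ x, f i x := by
  induction n with
  | zero => simp [volume_pi]
  | succ n ih =>
    rw [← (volume_preserving_piFinSuccAbove (fun _ : Fin (n + 1) => ℝ) 0).symm.lintegral_comp_emb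
      (MeasurableEquiv.measurableEmbedding _)]
    simp only [MeasurableEquiv.piFinSuccAbove_symm_apply, Fin.prod_univ_succ,
      Fin.insertNthEquiv_zero, Fin.consEquiv_apply, Fin.cons_zero, Fin.cons_succ]
    rw [volume_eq_prod, lintegral_prod_mul (g := fun y : Fin n → ℝ => ∏ i : Fin n, f i.succ (y i))
      (hf 0).aemeasurable, ih fun i => hf i.succ]
    exact (Finset.measurable_prod _ fun i _ =>
      (hf i.succ).comp (measurable_pi_apply i)).aemeasurable

theorem pi_withDensity_eq {n : ℕ} {f : Fin n → ℝ → ENNReal} (hf : ∀ i, Measurable (f i))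
    [∀ i, SigmaFinite ((volume : Measure ℝ).withDensity (f i))] :
    Measure.pi (fun i => (volume : Measure ℝ).withDensity (f i)) =
      (volume : Measure (Fin n → ℝ)).withDensity fun x => ∏ i, f i (x i) := by
  classical
  refine Measure.pi_eq fun s hs => ?_
  rw [withDensity_apply _ (MeasurableSet.univ_pi hs),
    ← lintegral_indicator (MeasurableSet.univ_pi hs)]
  have h : ∀ x : Fin n → ℝ, (Set.univ.pi s).indicator (fun x => ∏ i, f i (x i)) x =
      ∏ i, (s i).indicator (f i) (x i) := by
    intro x
    by_cases hx : x ∈ Set.univ.pi s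
    · rw [Set.indicator_of_mem hx]
      exact Finset.prod_congr rfl fun i _ => (Set.indicator_of_mem (hx i trivial) _).symm
    · rw [Set.indicator_of_notMem hx]
      simp only [Set.mem_pi, Set.mem_univ, true_imp_iff, not_forall] at hx
      obtain ⟨i, hi⟩ := hx
      exact (Finset.prod_eq_zero (Finset.mem_univ i) (Set.indicator_of_notMem hi _)).symm
  simp_rw [h]
  rw [lintegral_pi_prod_eq_prod fun i => (hf i).indicator (hs i)]
  refine Finset.prod_congr rfl fun i _ => ?_
  rw [lintegral_indicator (hs i), withDensity_apply _ (hs i)]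

theorem prod_gaussianPDFReal {n : ℕ} (σ : ℝ≥0) (s y : Vec n) :
    ∏ i, gaussianPDFReal (s i) (σ ^ 2) (y i) =
      (√(2 * Real.pi * (σ : ℝ) ^ 2))⁻¹ ^ n * Real.exp (-‖y - s‖ ^ 2 / (2 * (σ : ℝ) ^ 2)) := by
  simp only [gaussianPDFReal, Finset.prod_mul_distrib, Finset.prod_const, Finset.card_univ,
    Fintype.card_fin, ← Real.exp_sum, NNReal.coe_pow, EuclideanSpace.norm_sq_eq, PiLp.sub_apply,
    Real.norm_eq_abs, sq_abs, ← Finset.sum_neg_distrib, Finset.sum_div]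

theorem noiseLaw_eq_withDensity (n : ℕ) {σ : ℝ≥0} (hσ : 0 < σ) :
    noiseLaw n σ = (volume : Measure (Vec n)).withDensity fun z => ENNReal.ofReal
      ((√(2 * Real.pi * (σ : ℝ) ^ 2))⁻¹ ^ n * Real.exp (-‖z‖ ^ 2 / (2 * (σ : ℝ) ^ 2))) := by
  have hv : σ ^ 2 ≠ 0 := pow_ne_zero _ hσ.ne'
  have hsf : SigmaFinite ((volume : Measure ℝ).withDensity (gaussianPDF 0 (σ ^ 2))) := by
    rw [← gaussianReal_of_var_ne_zero _ hv]; infer_instance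
  have h1 : (Measure.pi fun _ : Fin n => gaussianReal 0 (σ ^ 2)) =
      (volume : Measure (Fin n → ℝ)).withDensity fun x => ENNReal.ofReal
      ((√(2 * Real.pi * (σ : ℝ) ^ 2))⁻¹ ^ n *
        Real.exp (-‖(WithLp.toLp 2 x : Vec n)‖ ^ 2 / (2 * (σ : ℝ) ^ 2))) := by
    rw [gaussianReal_of_var_ne_zero _ hv,
      pi_withDensity_eq fun _ => measurable_gaussianPDF 0 (σ ^ 2)]
    congr 1
    ext x
    simp only [gaussianPDF]
    rw [← ENNReal.ofReal_prod_of_nonneg fun i _ => gaussianPDFReal_nonneg _ _ _]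
    have := prod_gaussianPDFReal σ 0 (WithLp.toLp 2 x : Vec n)
    simp only [sub_zero] at this
    rw [← this]
    rfl
  ext A hA
  have hp := PiLp.volume_preserving_toLp (Fin n)
  rw [noiseLaw, h1, map_apply hp.measurable hA, withDensity_apply _ (hp.measurable hA),
    withDensity_apply _ hA, ← hp.setLIntegral_comp_preimage hA]
  fun_prop

section Polar
variable {E : Type*} [NormedAddCommGroup E] [NormedSpace ℝ E] [MeasurableSpace E] [BorelSpace E]
  [FiniteDimensional ℝ E]

/-- Integration in polar coordinates on a normed space. -/
theorem lintegral_eq_lintegral_toSphere [Nontrivial E] (μ : Measure E) [μ.IsAddHaarMeasure]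
    {f : E → ENNReal} (hf : Measurable f) :
    ∫⁻ x, f x ∂μ = ∫⁻ r in Set.Ioi (0 : ℝ), ENNReal.ofReal (r ^ (Module.finrank ℝ E - 1)) *
      ∫⁻ u, f (r • (u : E)) ∂μ.toSphere := by
  have hm' : Measurable fun p : sphere (0 : E) 1 × Set.Ioi (0 : ℝ) => f ((p.2 : ℝ) • (p.1 : E)) :=
    hf.comp (by fun_prop)
  calc
    ∫⁻ x, f x ∂μ = ∫⁻ x : ({(0)}ᶜ : Set E), f x ∂(μ.comap (↑)) := by
      rw [lintegral_subtype_comap (measurableSet_singleton _).compl f, restrict_compl_singleton]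
    _ = ∫⁻ p, f ((p.2 : ℝ) • (p.1 : E))
        ∂μ.toSphere.prod (volumeIoiPow (Module.finrank ℝ E - 1)) := by
      rw [← μ.measurePreserving_homeomorphUnitSphereProd.lintegral_comp hm']
      refine lintegral_congr fun x => ?_
      have hx : ‖(x : E)‖ ≠ 0 := norm_ne_zero_iff.2 x.2
      simp [smul_smul, hx]
    _ = ∫⁻ r, ∫⁻ u, f ((r : ℝ) • (u : E)) ∂μ.toSphere ∂(volumeIoiPow (Module.finrank ℝ E - 1)) :=
      lintegral_prod_symm' _ hm'
    _ = _ := by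
      rw [volumeIoiPow, lintegral_withDensity_eq_lintegral_mul _ (by fun_prop)
        (hm'.lintegral_prod_left'), ← lintegral_subtype_comap measurableSet_Ioi]
      rfl

end Polar

/-- The area of the unit sphere. -/
theorem toSphere_univ_eq {n : ℕ} (hn : 0 < n) :
    (volume : Measure (Vec n)).toSphere Set.univ =
      ENNReal.ofReal (2 * √Real.pi ^ n / Real.Gamma ((n : ℝ) / 2)) := by
  have : Nonempty (Fin n) := ⟨⟨0, hn⟩⟩
  have hn' : (0 : ℝ) < n := Nat.cast_pos.2 hn
  have hG : 0 < Real.Gamma ((n : ℝ) / 2) := Real.Gamma_pos_of_pos (by positivity)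
  rw [toSphere_apply_univ, EuclideanSpace.volume_ball, Fintype.card_fin, finrank_euclideanSpace_fin,
    ENNReal.ofReal_one, one_pow, one_mul, ← ENNReal.ofReal_natCast,
    ← ENNReal.ofReal_mul hn'.le, Real.Gamma_add_one (by positivity)]
  congr 1
  field_simp

theorem toSphere_real_univ_eq {n : ℕ} (hn : 0 < n) :
    (volume : Measure (Vec n)).toSphere.real Set.univ =
      2 * √Real.pi ^ n / Real.Gamma ((n : ℝ) / 2) := by
  have hn' : (0 : ℝ) < n := Nat.cast_pos.2 hn
  have hG : 0 < Real.Gamma ((n : ℝ) / 2) := Real.Gamma_pos_of_pos (by positivity)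
  rw [measureReal_def, toSphere_univ_eq hn, ENNReal.toReal_ofReal (by positivity)]

theorem radialDensity_nonneg {n : ℕ} (hn : 0 < n) (σ : ℝ≥0) (r : ℝ) : 0 ≤ radialDensity n σ r := by
  have hn' : (0 : ℝ) < n := Nat.cast_pos.2 hn
  have hG : 0 < Real.Gamma ((n : ℝ) / 2) := Real.Gamma_pos_of_pos (by positivity)
  unfold radialDensity
  split_ifs with h <;> positivity

/-- The density `g` is the area of the sphere of radius `r` times the noise density on it. -/
theorem toSphere_univ_mul_eq_radialDensity {n : ℕ} (hn : 0 < n) {σ : ℝ≥0} (hσ : 0 < σ) {r : ℝ}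
    (hr : 0 < r) :
    (volume : Measure (Vec n)).toSphere.real Set.univ * (r ^ (n - 1) *
      ((√(2 * Real.pi * (σ : ℝ) ^ 2))⁻¹ ^ n * Real.exp (-r ^ 2 / (2 * (σ : ℝ) ^ 2)))) =
      radialDensity n σ r := by
  have hσ' : (0 : ℝ) < σ := hσ
  have hn' : (0 : ℝ) < n := Nat.cast_pos.2 hn
  have hG : 0 < Real.Gamma ((n : ℝ) / 2) := Real.Gamma_pos_of_pos (by positivity)
  have h2 : (2 : ℝ) ^ ((n : ℝ) / 2) = √2 ^ n := by
    rw [Real.sqrt_eq_rpow, ← Real.rpow_natCast, ← Real.rpow_mul (by norm_num)]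
    congr 1; ring
  rw [toSphere_real_univ_eq hn, radialDensity, if_pos hr.le, h2, Real.sqrt_mul (by positivity),
    Real.sqrt_mul (by positivity), Real.sqrt_sq hσ'.le, inv_pow, mul_pow, mul_pow]
  have : 0 < √Real.pi := Real.sqrt_pos.2 Real.pi_pos
  field_simp

/-- Under the noise law the radius has density `g` and the direction is independent of it and
uniform on the unit sphere. -/
theorem lintegral_noiseLaw {n : ℕ} (hn : 0 < n) {σ : ℝ≥0} (hσ : 0 < σ) {f : Vec n → ENNReal}
    (hf : Measurable f) :
    ∫⁻ z, f z ∂noiseLaw n σ = ∫⁻ r in Set.Ioi (0 : ℝ), ENNReal.ofReal (radialDensity n σ r) *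
      (((volume : Measure (Vec n)).toSphere Set.univ)⁻¹ *
        ∫⁻ u, f (r • (u : Vec n)) ∂(volume : Measure (Vec n)).toSphere) := by
  have : Nonempty (Fin n) := ⟨⟨0, hn⟩⟩
  rw [noiseLaw_eq_withDensity n hσ, lintegral_withDensity_eq_lintegral_mul _ (by fun_prop) hf,
    lintegral_eq_lintegral_toSphere _ (by fun_prop)]
  refine setLIntegral_congr_fun measurableSet_Ioi fun r hr => ?_
  have hr' : 0 < r := hr
  have hS : (volume : Measure (Vec n)).toSphere Set.univ ≠ 0 :=
    measure_univ_ne_zero.2 (toSphere_ne_zero _)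
  have hS' : (volume : Measure (Vec n)).toSphere Set.univ ≠ ⊤ := measure_ne_top _ _
  have hu : ∀ u : sphere (0 : Vec n) 1, ‖r • (u : Vec n)‖ = r := fun u => by
    simp [norm_smul, abs_of_pos hr']
  have hfm : Measurable fun u : sphere (0 : Vec n) 1 => f (r • (u : Vec n)) :=
    hf.comp (by fun_prop)
  simp only [Pi.mul_apply, hu]
  rw [lintegral_const_mul _ hfm, ← mul_assoc, ← mul_assoc,
    ← toSphere_univ_mul_eq_radialDensity hn hσ hr', ENNReal.ofReal_mul measureReal_nonneg,
    ofReal_measureReal, mul_right_comm _ _ (_⁻¹), ENNReal.mul_inv_cancel hS hS', one_mul,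
    ENNReal.ofReal_mul (p := r ^ (n - 1)) (by positivity), finrank_euclideanSpace_fin]

/-- A random vector with the noise law has norm distributed with density `g`. -/
theorem map_norm_noiseLaw {n : ℕ} (hn : 0 < n) {σ : ℝ≥0} (hσ : 0 < σ) :
    (noiseLaw n σ).map (fun z => ‖z‖) =
      volume.withDensity fun r => ENNReal.ofReal (radialDensity n σ r) := by
  have : Nonempty (Fin n) := ⟨⟨0, hn⟩⟩
  ext A hA
  have hS : (volume : Measure (Vec n)).toSphere Set.univ ≠ 0 :=
    measure_univ_ne_zero.2 (toSphere_ne_zero _)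
  have hS' : (volume : Measure (Vec n)).toSphere Set.univ ≠ ⊤ := measure_ne_top _ _
  have hm : MeasurableSet ((fun z : Vec n => ‖z‖) ⁻¹' A) := measurable_norm hA
  rw [map_apply measurable_norm hA, ← lintegral_indicator_one hm,
    lintegral_noiseLaw hn hσ (measurable_one.indicator hm), withDensity_apply _ hA,
    ← lintegral_indicator hA, ← lintegral_indicator measurableSet_Ioi]
  -- The two integrands agree except possibly at the origin.
  refine lintegral_congr_ae ?_
  filter_upwards [compl_mem_ae_iff.2 (measure_singleton (μ := volume) (0 : ℝ))] with r hr
  rcases lt_or_gt_of_ne hr with h | h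
  · simp [h.not_gt, Set.indicator, radialDensity, h.not_ge]
  · have hu : ∀ u : sphere (0 : Vec n) 1, ‖r • (u : Vec n)‖ = r := fun u => by
      simp [norm_smul, abs_of_pos h]
    rw [Set.indicator_of_mem (by exact h)]
    by_cases hrA : r ∈ A
    · simp [Set.indicator, hu, hrA, ENNReal.inv_mul_cancel hS hS', - toSphere_apply_univ]
    · simp [Set.indicator, hu, hrA]

@[fun_prop]
theorem measurable_radialDensity (n : ℕ) (σ : ℝ≥0) : Measurable (radialDensity n σ) := by
  unfold radialDensity
  exact Measurable.ite measurableSet_Ici (by fun_prop) measurable_const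

theorem isProbabilityMeasure_noiseLaw (n : ℕ) (σ : ℝ≥0) : IsProbabilityMeasure (noiseLaw n σ) :=
  isProbabilityMeasure_map (PiLp.volume_preserving_toLp (Fin n)).measurable.aemeasurable

theorem integrable_radialDensity {n : ℕ} (hn : 0 < n) {σ : ℝ≥0} (hσ : 0 < σ) :
    Integrable (radialDensity n σ) := by
  have := isProbabilityMeasure_noiseLaw n σ
  refine ⟨(measurable_radialDensity n σ).aestronglyMeasurable, ?_⟩
  rw [hasFiniteIntegral_iff_ofReal (ae_of_all _ (radialDensity_nonneg hn σ)),
    ← setLIntegral_univ, ← withDensity_apply _ .univ, ← map_norm_noiseLaw hn hσ]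
  exact (measure_mono (Set.subset_univ _)).trans_lt (by
    have := isProbabilityMeasure_map (μ := noiseLaw n σ) (measurable_norm (α := Vec n)).aemeasurable
    exact measure_lt_top _ _)

theorem map_norm_sub_receivedLaw {n : ℕ} (hn : 0 < n) {σ : ℝ≥0} (hσ : 0 < σ) (s : Vec n) :
    (receivedLaw σ s).map (fun y => ‖y - s‖) =
      volume.withDensity fun r => ENNReal.ofReal (radialDensity n σ r) := by
  rw [receivedLaw, map_map (by fun_prop) (by fun_prop), ← map_norm_noiseLaw hn hσ]
  congr 1
  ext z
  simp

/-! ### The area of a spherical cap -/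

/-- Splitting off the first coordinate in Euclidean space. -/
theorem lintegral_euclidean_succ {k : ℕ} {F : ℝ × ℝ → ENNReal} (hF : Measurable F) :
    ∫⁻ y : Vec (k + 1), F (y 0, ‖y‖) =
      ∫⁻ x : ℝ, ∫⁻ y : Vec k, F (x, √(x ^ 2 + ‖y‖ ^ 2)) := by
  have hp := (PiLp.volume_preserving_toLp (Fin (k + 1)))
  have hq := (PiLp.volume_preserving_toLp (Fin k))
  have he := (volume_preserving_piFinSuccAbove (fun _ : Fin (k + 1) => ℝ) 0).symm
  have h1 : Measurable fun y : Vec (k + 1) => F (y 0, ‖y‖) := by fun_prop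
  have h2 : Measurable fun y : Fin (k + 1) → ℝ =>
      F (y 0, ‖(WithLp.toLp 2 y : Vec (k + 1))‖) := h1.comp hp.measurable
  have h4 : Measurable fun q : ℝ × (Fin k → ℝ) =>
      F ((MeasurableEquiv.piFinSuccAbove (fun _ : Fin (k + 1) => ℝ) 0).symm q 0,
        ‖(WithLp.toLp 2 ((MeasurableEquiv.piFinSuccAbove (fun _ : Fin (k + 1) => ℝ) 0).symm q) :
          Vec (k + 1))‖) := h2.comp he.measurable
  rw [← hp.lintegral_comp h1, ← he.lintegral_comp h2, volume_eq_prod,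
    lintegral_prod _ h4.aemeasurable]
  refine lintegral_congr fun x => ?_
  have h3 : Measurable fun y : Vec k => F (x, √(x ^ 2 + ‖y‖ ^ 2)) := by fun_prop
  rw [← hq.lintegral_comp h3]
  refine lintegral_congr fun y => ?_
  simp [EuclideanSpace.norm_eq, Fin.sum_univ_succ, Real.sq_sqrt, Finset.sum_nonneg, sq_nonneg]

/-- Polar coordinates about the first axis: a function of the first coordinate and the norm is
integrated over the radius and the angle `θ` with the axis. -/
theorem lintegral_axial {k : ℕ} (hk : 0 < k) {F : ℝ × ℝ → ENNReal} (hF : Measurable F) :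
    ∫⁻ y : Vec (k + 1), F (y 0, ‖y‖) = (volume : Measure (Vec k)).toSphere Set.univ *
      ∫⁻ r in Set.Ioi (0 : ℝ), ∫⁻ θ in Set.Ioo 0 Real.pi,
        ENNReal.ofReal (r ^ k) * ENNReal.ofReal (Real.sin θ ^ (k - 1)) *
          F (r * Real.cos θ, r) := by
  have : Nonempty (Fin k) := ⟨⟨0, hk⟩⟩
  -- The integrand in the half-plane of pairs (axial coordinate, distance to the axis).
  set G : ℝ × ℝ → ENNReal := fun p => (Set.Ioi (0 : ℝ)).indicator
    (fun ρ => ENNReal.ofReal (ρ ^ (k - 1)) * F (p.1, √(p.1 ^ 2 + ρ ^ 2))) p.2 with hG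
  have hGm : Measurable G := by
    have : Measurable fun p : ℝ × ℝ =>
        ENNReal.ofReal (p.2 ^ (k - 1)) * F (p.1, √(p.1 ^ 2 + p.2 ^ 2)) :=
      Measurable.mul (by fun_prop) (hF.comp (by fun_prop))
    exact this.indicator (measurable_snd measurableSet_Ioi)
  have h1 : ∀ x : ℝ, ∫⁻ y : Vec k, F (x, √(x ^ 2 + ‖y‖ ^ 2)) =
      (volume : Measure (Vec k)).toSphere Set.univ * ∫⁻ ρ, G (x, ρ) := by
    intro x
    have hm : Measurable fun y : Vec k => F (x, √(x ^ 2 + ‖y‖ ^ 2)) := by fun_prop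
    have hGx : Measurable fun ρ => G (x, ρ) := by fun_prop
    rw [lintegral_eq_lintegral_toSphere _ hm,
      ← lintegral_const_mul _ hGx, ← lintegral_indicator measurableSet_Ioi]
    refine lintegral_congr fun ρ => ?_
    by_cases hρ : ρ ∈ Set.Ioi (0 : ℝ)
    · have hu : ∀ u : sphere (0 : Vec k) 1, ‖ρ • (u : Vec k)‖ = ρ := fun u => by
        simp [norm_smul, abs_of_pos (show 0 < ρ from hρ)]
      simp only [hG, Set.indicator_of_mem hρ, hu, lintegral_const, finrank_euclideanSpace_fin]
      ring
    · simp [hG, Set.indicator_of_notMem hρ]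
  rw [lintegral_euclidean_succ hF]
  simp_rw [h1]
  rw [lintegral_const_mul _ hGm.lintegral_prod_right', ← lintegral_prod _ hGm.aemeasurable]
  congr 1
  rw [← volume_eq_prod, ← lintegral_comp_polarCoord_symm, polarCoord_target, volume_eq_prod,
    ← Measure.prod_restrict, lintegral_prod]
  · refine setLIntegral_congr_fun measurableSet_Ioi fun r hr => ?_
    have hr' : 0 < r := hr
    simp only [polarCoord_symm_apply, smul_eq_mul]
    rw [← lintegral_indicator measurableSet_Ioo, ← lintegral_indicator measurableSet_Ioo]
    refine lintegral_congr fun θ => ?_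
    by_cases hθ : θ ∈ Set.Ioo 0 Real.pi
    · have hs : 0 < Real.sin θ := Real.sin_pos_of_mem_Ioo hθ
      have hθ' : θ ∈ Set.Ioo (-Real.pi) Real.pi := ⟨by linarith [hθ.1, Real.pi_pos], hθ.2⟩
      have hrs : r * Real.sin θ ∈ Set.Ioi (0 : ℝ) := mul_pos hr' hs
      have hsq : (r * Real.cos θ) ^ 2 + (r * Real.sin θ) ^ 2 = r ^ 2 := by
        linear_combination r ^ 2 * Real.sin_sq_add_cos_sq θ
      simp only [hG, Set.indicator_of_mem hθ, Set.indicator_of_mem hθ', Set.indicator_of_mem hrs,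
        hsq, Real.sqrt_sq hr'.le]
      rw [← mul_assoc, ← ENNReal.ofReal_mul hr'.le, ← ENNReal.ofReal_mul (by positivity)]
      congr 2
      obtain ⟨j, rfl⟩ : ∃ j, k = j + 1 := ⟨k - 1, by omega⟩
      simp only [Nat.add_sub_cancel]
      ring
    · rw [Set.indicator_of_notMem hθ]
      refine Set.indicator_apply_eq_zero.2 fun hθ' => ?_
      have hs : Real.sin θ ≤ 0 :=
        Real.sin_nonpos_of_nonpos_of_neg_pi_le (by
          by_contra h; exact hθ ⟨not_le.1 h, hθ'.2⟩) hθ'.1.le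
      have hrs : r * Real.sin θ ∉ Set.Ioi (0 : ℝ) :=
        fun h => (mul_nonpos_of_nonneg_of_nonpos hr'.le hs).not_gt h
      simp only [hG, Set.indicator_of_notMem hrs, mul_zero]
  · refine Measurable.aemeasurable (Measurable.mul (by fun_prop) (hGm.comp ?_))
    exact continuous_polarCoord_symm.measurable

/-- Holds for all real `c`, since `arccos` is `0` beyond `1` and `π` below `-1`. -/
theorem le_cos_iff_le_arccos {c θ : ℝ} (h0 : 0 < θ) (hpi : θ < Real.pi) :
    c ≤ Real.cos θ ↔ θ ≤ Real.arccos c := by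
  constructor
  · intro h
    rw [← Real.arccos_cos h0.le hpi.le]
    exact Real.arccos_le_arccos h
  · intro h
    rcases lt_or_ge 1 c with hc | hc
    · rw [Real.arccos_of_one_le hc.le] at h
      exact absurd h h0.not_ge
    rcases lt_or_ge c (-1) with hc' | hc'
    · exact hc'.le.trans (Real.neg_one_le_cos θ)
    · calc c = Real.cos (Real.arccos c) := (Real.cos_arccos hc' hc).symm
        _ ≤ Real.cos θ := Real.cos_le_cos_of_nonneg_of_le_pi h0.le (Real.arccos_le_pi c) h

theorem lintegral_sin_pow_cap (m : ℕ) (c : ℝ) :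
    ∫⁻ θ in Set.Ioo 0 Real.pi, ENNReal.ofReal (Real.sin θ ^ m) *
      (Set.Ici c).indicator 1 (Real.cos θ) =
    ENNReal.ofReal (∫ θ in (0 : ℝ)..Real.arccos c, Real.sin θ ^ m) := by
  rw [intervalIntegral.integral_of_le (Real.arccos_nonneg c), integral_Ioc_eq_integral_Ioo,
    ofReal_integral_eq_lintegral_ofReal]
  · rw [← lintegral_indicator measurableSet_Ioo, ← lintegral_indicator measurableSet_Ioo]
    refine lintegral_congr_ae ?_
    filter_upwards [compl_mem_ae_iff.2 (measure_singleton (μ := volume) (Real.arccos c))] with θ hθ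
    have hθ' : θ ≠ Real.arccos c := hθ
    by_cases h : θ ∈ Set.Ioo 0 Real.pi
    · rw [Set.indicator_of_mem h]
      have := le_cos_iff_le_arccos (c := c) h.1 h.2
      by_cases h' : θ < Real.arccos c
      · rw [Set.indicator_of_mem (show θ ∈ Set.Ioo 0 (Real.arccos c) from ⟨h.1, h'⟩),
          Set.indicator_of_mem (show Real.cos θ ∈ Set.Ici c from this.2 h'.le)]
        simp
      · rw [Set.indicator_of_notMem (fun hh : θ ∈ Set.Ioo 0 (Real.arccos c) => h' hh.2),
          Set.indicator_of_notMem (fun hh : Real.cos θ ∈ Set.Ici c =>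
            h' ((this.1 hh).lt_of_ne hθ')), mul_zero]
    · rw [Set.indicator_of_notMem h, Set.indicator_of_notMem]
      exact fun hh => h ⟨hh.1, hh.2.trans_le (Real.arccos_le_pi c)⟩
  · exact ((by fun_prop : Continuous fun θ => Real.sin θ ^ m).integrableOn_Icc).mono_set
      Set.Ioo_subset_Icc_self
  · filter_upwards [ae_restrict_mem measurableSet_Ioo] with θ hθ
    exact pow_nonneg (Real.sin_nonneg_of_nonneg_of_le_pi hθ.1.le
      (hθ.2.le.trans (Real.arccos_le_pi c))) _

/-- The area of a spherical cap: `u` lies in the cap if its angle with the unit vector `e` is at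
most `arccos c`. -/
theorem toSphere_cap {k : ℕ} (hk : 0 < k) {e : Vec (k + 1)} (he : ‖e‖ = 1) (c : ℝ) :
    (volume : Measure (Vec (k + 1))).toSphere {u | c ≤ inner ℝ e (u : Vec (k + 1))} =
      (volume : Measure (Vec k)).toSphere Set.univ *
        ENNReal.ofReal (∫ θ in (0 : ℝ)..Real.arccos c, Real.sin θ ^ (k - 1)) := by
  -- An orthonormal basis with first vector `e` turns `⟪e, x⟫` into a coordinate.
  have hv : Orthonormal ℝ (({0} : Set (Fin (k + 1))).domRestrict fun _ => e) := by
    refine ⟨fun _ => he, fun i j hij => absurd (Subsingleton.elim i j) hij⟩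
  obtain ⟨b, hb⟩ := hv.exists_orthonormalBasis_extension_of_card_eq (by simp)
  have hb0 : b 0 = e := hb 0 rfl
  have hbe : ∀ x, b.repr x 0 = inner ℝ e x := fun x => by rw [b.repr_apply_apply, hb0]
  -- Both sides are compared with the volume of the part of the unit ball in the cone over the cap.
  set F : ℝ × ℝ → ENNReal := fun p => (Set.Iio (1 : ℝ)).indicator 1 p.2 *
    ({q : ℝ × ℝ | c * q.2 ≤ q.1}).indicator 1 p with hF
  have hFm : Measurable F := by
    refine Measurable.mul ((measurable_one.indicator measurableSet_Iio).comp measurable_snd) ?_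
    exact measurable_one.indicator (measurableSet_le (by fun_prop) (by fun_prop))
  have hFe : Measurable fun x : Vec (k + 1) => F (inner ℝ e x, ‖x‖) := by fun_prop
  have hF0 : Measurable fun x : Vec (k + 1) => F (x 0, ‖x‖) := by fun_prop
  have hKm : Measurable fun r : ℝ =>
      ENNReal.ofReal (r ^ k) * (Set.Iio (1 : ℝ)).indicator 1 r :=
    Measurable.mul (by fun_prop) (measurable_one.indicator measurableSet_Iio)
  set K : ENNReal := ∫⁻ r in Set.Ioi (0 : ℝ), ENNReal.ofReal (r ^ k) *
    (Set.Iio (1 : ℝ)).indicator 1 r with hK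
  have hKv : K = ENNReal.ofReal (1 / (k + 1)) := by
    have := volumeIoiPow_apply_Iio k ⟨1, Set.mem_Ioi.2 one_pos⟩
    rw [one_pow] at this
    rw [← this, volumeIoiPow, withDensity_apply _ measurableSet_Iio,
      ← lintegral_indicator measurableSet_Iio, hK, ← lintegral_subtype_comap measurableSet_Ioi]
    refine lintegral_congr fun r => ?_
    simp [Set.indicator, ← Subtype.coe_lt_coe]
  have hK0 : K ≠ 0 := by
    rw [hKv]; exact (ENNReal.ofReal_pos.2 (by positivity)).ne'
  have hKt : K ≠ ⊤ := by rw [hKv]; exact ENNReal.ofReal_ne_top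
  have hL : ∫⁻ x : Vec (k + 1), F (inner ℝ e x, ‖x‖) =
      K * (volume : Measure (Vec (k + 1))).toSphere
        {u | c ≤ inner ℝ e (u : Vec (k + 1))} := by
    rw [lintegral_eq_lintegral_toSphere _ hFe, hK, ← lintegral_mul_const _ hKm]
    refine setLIntegral_congr_fun measurableSet_Ioi fun r hr => ?_
    have hr' : 0 < r := hr
    have hms : MeasurableSet {u : sphere (0 : Vec (k + 1)) 1 | c ≤ inner ℝ e (u : Vec (k + 1))} :=
      measurableSet_le (by fun_prop) (by fun_prop)
    have hu : ∀ u : sphere (0 : Vec (k + 1)) 1, F (inner ℝ e (r • (u : Vec (k + 1))),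
        ‖r • (u : Vec (k + 1))‖) = (Set.Iio (1 : ℝ)).indicator 1 r *
        ({u : sphere (0 : Vec (k + 1)) 1 | c ≤ inner ℝ e (u : Vec (k + 1))}).indicator 1 u := by
      intro u
      have h1 : ‖r • (u : Vec (k + 1))‖ = r := by simp [norm_smul, abs_of_pos hr']
      have h2 : c * r ≤ r * inner ℝ e (u : Vec (k + 1)) ↔ c ≤ inner ℝ e (u : Vec (k + 1)) := by
        rw [mul_comm c r, mul_le_mul_iff_right₀ hr']
      simp only [hF, h1, real_inner_smul_right, Set.indicator, Set.mem_ofPred_eq, h2, Pi.one_apply]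
    simp only [hu]
    rw [lintegral_const_mul _ (measurable_one.indicator hms), lintegral_indicator_one hms,
      finrank_euclideanSpace_fin, Nat.add_sub_cancel, mul_assoc]
  have hR : ∫⁻ x : Vec (k + 1), F (inner ℝ e x, ‖x‖) =
      K * ((volume : Measure (Vec k)).toSphere Set.univ *
        ENNReal.ofReal (∫ θ in (0 : ℝ)..Real.arccos c, Real.sin θ ^ (k - 1))) := by
    have h1 : ∫⁻ x : Vec (k + 1), F (inner ℝ e x, ‖x‖) =
        ∫⁻ y : Vec (k + 1), F (y 0, ‖y‖) := by
      rw [← b.measurePreserving_repr.lintegral_comp hF0]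
      simp only [hbe, LinearIsometryEquiv.norm_map]
    rw [h1, lintegral_axial hk hFm, mul_left_comm, hK, ← lintegral_mul_const _ hKm]
    congr 1
    refine setLIntegral_congr_fun measurableSet_Ioi fun r hr => ?_
    have hr' : 0 < r := hr
    have hms : Measurable fun θ => ENNReal.ofReal (Real.sin θ ^ (k - 1)) *
        (Set.Ici c).indicator (1 : ℝ → ENNReal) (Real.cos θ) :=
      Measurable.mul (by fun_prop)
        ((measurable_one.indicator measurableSet_Ici).comp Real.measurable_cos)
    rw [← lintegral_sin_pow_cap, ← lintegral_const_mul _ hms]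
    refine lintegral_congr fun θ => ?_
    have h2 : c * r ≤ r * Real.cos θ ↔ c ≤ Real.cos θ := by
      rw [mul_comm c r, mul_le_mul_iff_right₀ hr']
    simp only [hF, Set.indicator, Set.mem_ofPred_eq, h2, Set.mem_Ici, Pi.one_apply]
    ring
  exact (ENNReal.mul_right_inj hK0 hKt).1 (hL.symm.trans hR)

/-! ### The sphere bound -/

/-- The points of a sphere about `s` at least as close to `t` as to `s` form a spherical cap. -/
theorem norm_sub_le_iff_le_inner {n : ℕ} {s t : Vec n} (hst : s ≠ t) {r : ℝ} (hr : 0 < r)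
    (u : Vec n) :
    ‖(s + r • u) - t‖ ≤ ‖(s + r • u) - s‖ ↔
      dist s t / (2 * r) ≤ inner ℝ (‖t - s‖⁻¹ • (t - s)) u := by
  have hd : 0 < ‖t - s‖ := norm_pos_iff.2 (sub_ne_zero.2 hst.symm)
  have h1 : (s + r • u) - t = r • u - (t - s) := by abel
  rw [add_sub_cancel_left, h1, ← sq_le_sq₀ (norm_nonneg _) (norm_nonneg _), norm_sub_sq_real,
    real_inner_smul_left, real_inner_smul_left, dist_comm, dist_eq_norm,
    div_le_iff₀ (by positivity), ← mul_le_mul_iff_right₀ (b := ‖t - s‖) hd, real_inner_comm]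
  have h2 : ‖t - s‖ * (‖t - s‖⁻¹ * inner ℝ (t - s) u * (2 * r)) =
      2 * (r * inner ℝ (t - s) u) := by
    field_simp
  rw [h2]
  constructor <;> intro h <;> linarith

/-- The closed form of the fraction of a sphere that a bisector cuts off. -/
theorem sphereFraction_eq_pairError {n : ℕ} (hn : 2 ≤ n) {s t : Vec n} (hst : s ≠ t) {r : ℝ}
    (hr : 0 < r) : sphereFraction s t r = pairError n r (dist s t) := by
  obtain ⟨k, rfl⟩ : ∃ k, n = k + 1 := ⟨n - 1, by omega⟩
  have hk : 0 < k := by omega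
  have hk' : (0 : ℝ) < k := Nat.cast_pos.2 hk
  have hd : 0 < ‖t - s‖ := norm_pos_iff.2 (sub_ne_zero.2 hst.symm)
  have he : ‖‖t - s‖⁻¹ • (t - s)‖ = 1 := by
    rw [norm_smul, norm_inv, norm_norm, inv_mul_cancel₀ hd.ne']
  have hI : 0 ≤ ∫ θ in (0 : ℝ)..Real.arccos (dist s t / (2 * r)), Real.sin θ ^ (k - 1) :=
    intervalIntegral.integral_nonneg (Real.arccos_nonneg _) fun θ hθ =>
      pow_nonneg (Real.sin_nonneg_of_nonneg_of_le_pi hθ.1 (hθ.2.trans (Real.arccos_le_pi _))) _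
  have hG1 : 0 < Real.Gamma (((k + 1 : ℕ) : ℝ) / 2) := Real.Gamma_pos_of_pos (by positivity)
  have hG2 : 0 < Real.Gamma ((k : ℝ) / 2) := Real.Gamma_pos_of_pos (by positivity)
  have hpi : 0 < √Real.pi := Real.sqrt_pos.2 Real.pi_pos
  simp only [sphereFraction, norm_sub_le_iff_le_inner hst hr]
  rw [measureReal_def, toSphere_cap hk he, ENNReal.toReal_mul, ENNReal.toReal_ofReal hI,
    ← measureReal_def, toSphere_real_univ_eq hk, toSphere_real_univ_eq (Nat.succ_pos k), pairError]
  split_ifs with h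
  · have h2 : ((k + 1 : ℕ) : ℝ) - 1 = k := by push_cast; ring
    rw [h2, show k + 1 - 2 = k - 1 by omega]
    rw [Nat.succ_eq_add_one, pow_succ]
    field_simp
  · have h2 : Real.arccos (dist s t / (2 * r)) = 0 := by
      refine Real.arccos_of_one_le ?_
      rw [one_le_div (by positivity)]
      linarith
    simp [h2]

theorem pairError_nonneg {n : ℕ} (hn : 2 ≤ n) (r δ : ℝ) : 0 ≤ pairError n r δ := by
  have hn' : (2 : ℝ) ≤ n := by exact_mod_cast hn
  have hG1 : 0 < Real.Gamma ((n : ℝ) / 2) := Real.Gamma_pos_of_pos (by positivity)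
  have hG2 : 0 < Real.Gamma (((n : ℝ) - 1) / 2) := Real.Gamma_pos_of_pos (by linarith)
  have hI : 0 ≤ ∫ θ in (0 : ℝ)..Real.arccos (δ / (2 * r)), Real.sin θ ^ (n - 2) :=
    intervalIntegral.integral_nonneg (Real.arccos_nonneg _) fun θ hθ =>
      pow_nonneg (Real.sin_nonneg_of_nonneg_of_le_pi hθ.1 (hθ.2.trans (Real.arccos_le_pi _))) _
  unfold pairError
  split_ifs with h
  · positivity
  · exact le_rfl

@[fun_prop]
theorem measurable_pairError (n : ℕ) (δ : ℝ) : Measurable fun r => pairError n r δ := by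
  have hI : Continuous fun x : ℝ => ∫ θ in (0 : ℝ)..x, Real.sin θ ^ (n - 2) :=
    intervalIntegral.continuous_primitive (fun a b =>
      (by fun_prop : Continuous fun θ => Real.sin θ ^ (n - 2)).intervalIntegrable a b) 0
  have hm : Measurable fun r : ℝ =>
      ∫ θ in (0 : ℝ)..Real.arccos (δ / (2 * r)), Real.sin θ ^ (n - 2) :=
    hI.measurable.comp (Real.continuous_arccos.measurable.comp (by fun_prop))
  unfold pairError
  exact Measurable.ite measurableSet_Ioi (hm.const_mul _) measurable_const

/-- The function `min (U r) 1 * g r` is integrable because `g` is. -/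
theorem integrable_min_one_mul_radialDensity {n : ℕ} (hn : 0 < n) {σ : ℝ≥0} (hσ : 0 < σ)
    {U : ℝ → ℝ} (hU : Measurable U) (hU0 : ∀ r, 0 ≤ U r) :
    Integrable fun r => min (U r) 1 * radialDensity n σ r := by
  refine (integrable_radialDensity hn hσ).bdd_mul (c := 1)
    (hU.min measurable_const).aestronglyMeasurable (ae_of_all _ fun r => ?_)
  rw [Real.norm_of_nonneg (le_min (hU0 r) zero_le_one)]
  exact min_le_right _ _

/-- The union bound on the conditional error probability, given that `s` is sent and the noise
has norm `r`. -/
noncomputable def condUnionBound {n : ℕ} (C : Finset (Vec n)) (s : Vec n) (r : ℝ) : ℝ :=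
  ∑ t ∈ C with s ≠ t, pairError n r (dist s t)

theorem condUnionBound_nonneg {n : ℕ} (hn : 2 ≤ n) (C : Finset (Vec n)) (s : Vec n) (r : ℝ) :
    0 ≤ condUnionBound C s r :=
  Finset.sum_nonneg fun _ _ => pairError_nonneg hn _ _

theorem measurable_condUnionBound {n : ℕ} (C : Finset (Vec n)) (s : Vec n) :
    Measurable (condUnionBound C s) := by
  unfold condUnionBound
  fun_prop

/-- A codeword at least as likely as `s` is at least as close to the received vector. -/
theorem norm_sub_le_of_likelihood_le {n : ℕ} {σ : ℝ≥0} (hσ : 0 < σ) {s t y : Vec n}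
    (h : likelihood σ s y ≤ likelihood σ t y) : ‖y - t‖ ≤ ‖y - s‖ := by
  have hσ' : (0 : ℝ) < σ := hσ
  have hc : 0 < (√(2 * Real.pi * (σ : ℝ) ^ 2))⁻¹ ^ n := by
    have := Real.pi_pos
    positivity
  rw [likelihood, likelihood, prod_gaussianPDFReal, prod_gaussianPDFReal,
    mul_le_mul_iff_right₀ hc, Real.exp_le_exp, div_le_div_iff_of_pos_right (by positivity),
    neg_le_neg_iff, sq_le_sq₀ (norm_nonneg _) (norm_nonneg _)] at h
  exact h

/-- Given that `s` is sent and the noise has norm `r`, the noise direction is uniform, so an error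
has probability at most the sum of the areas of the caps, and at most one. -/
theorem condErrorProb_le {n : ℕ} (hn : 2 ≤ n) {σ : ℝ≥0} (hσ : 0 < σ) {C : Finset (Vec n)}
    {dec : Vec n → Vec n} (hdec : IsMLDecoder σ C dec) {s : Vec n}
    (hs : s ∈ C) :
    condErrorProb σ dec s ≤
      ∫ r in Set.Ioi (0 : ℝ), min (condUnionBound C s r) 1 * radialDensity n σ r := by
  classical
  have hn0 : 0 < n := by omega
  have : Nonempty (Fin n) := ⟨⟨0, hn0⟩⟩
  set S := (volume : Measure (Vec n)).toSphere
  have hS : S Set.univ ≠ 0 := measure_univ_ne_zero.2 (toSphere_ne_zero _)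
  -- The noise vectors for which some other codeword is at least as close as `s`.
  set B : Set (Vec n) := ⋃ t ∈ C.filter (s ≠ ·), {z | ‖(s + z) - t‖ ≤ ‖(s + z) - s‖} with hB
  have hBm : MeasurableSet B := Finset.measurableSet_biUnion _ fun t _ =>
    measurableSet_le (by fun_prop) (by fun_prop)
  -- Only this inclusion is used: the error event itself need not be measurable.
  have hsub : {y | dec y ≠ s} ⊆ (fun y => -s + y) ⁻¹' B := by
    intro y hy
    have hle := norm_sub_le_of_likelihood_le hσ ((hdec y).2 s hs)
    simp only [hB, Set.mem_preimage, Set.mem_iUnion, Set.mem_ofPred_eq, Finset.mem_filter]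
    exact ⟨dec y, ⟨(hdec y).1, Ne.symm hy⟩, by simpa using hle⟩
  have hcap : ∀ r ∈ Set.Ioi (0 : ℝ), ENNReal.ofReal (radialDensity n σ r) *
      ((S Set.univ)⁻¹ * ∫⁻ u, B.indicator 1 (r • (u : Vec n)) ∂S) ≤
      ENNReal.ofReal (min (condUnionBound C s r) 1 * radialDensity n σ r) := by
    intro r hr
    have hr' : 0 < r := hr
    have hind : ∫⁻ u, B.indicator 1 (r • (u : Vec n)) ∂S =
        S {u : sphere (0 : Vec n) 1 | r • (u : Vec n) ∈ B} := by
      have hm : Measurable fun u : sphere (0 : Vec n) 1 => r • (u : Vec n) := by fun_prop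
      exact lintegral_indicator_one (hm hBm)
    rw [hind, mul_comm, ENNReal.ofReal_mul (le_min (condUnionBound_nonneg hn C s r) zero_le_one)]
    gcongr
    rw [mul_comm, ← div_eq_mul_inv, ENNReal.ofReal_min, ENNReal.ofReal_one]
    refine le_min ?_ ?_
    · rw [condUnionBound, ENNReal.ofReal_sum_of_nonneg fun t _ => pairError_nonneg hn _ _]
      have hset : {u : sphere (0 : Vec n) 1 | r • (u : Vec n) ∈ B} =
          ⋃ t ∈ C.filter (s ≠ ·), {u : sphere (0 : Vec n) 1 |
            ‖(s + r • (u : Vec n)) - t‖ ≤ ‖(s + r • (u : Vec n)) - s‖} := by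
        ext u; simp [hB]
      rw [hset]
      refine (ENNReal.div_le_div_right (measure_biUnion_finset_le _ _) _).trans ?_
      rw [div_eq_mul_inv, Finset.sum_mul]
      refine Finset.sum_le_sum fun t ht => ?_
      rw [← sphereFraction_eq_pairError hn (Finset.mem_filter.1 ht).2 hr', sphereFraction,
        measureReal_def, measureReal_def, ← ENNReal.toReal_div,
        ENNReal.ofReal_toReal (ENNReal.div_ne_top (measure_ne_top _ _) hS), div_eq_mul_inv]
    · exact ENNReal.div_le_of_le_mul (by rw [one_mul]; exact measure_mono (Set.subset_univ _))
  have hint := (integrable_min_one_mul_radialDensity hn0 hσ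
    (measurable_condUnionBound C s) (condUnionBound_nonneg hn C s)).integrableOn (s := Set.Ioi 0)
  have hnonneg : ∀ r, 0 ≤ min (condUnionBound C s r) 1 * radialDensity n σ r := fun r =>
    mul_nonneg (le_min (condUnionBound_nonneg hn C s r) zero_le_one) (radialDensity_nonneg hn0 σ r)
  rw [condErrorProb, measureReal_def]
  refine ENNReal.toReal_le_of_le_ofReal (integral_nonneg hnonneg) ?_
  calc receivedLaw σ s {y | dec y ≠ s}
      ≤ receivedLaw σ s ((fun y => -s + y) ⁻¹' B) := measure_mono hsub
    _ = noiseLaw n σ B := by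
        rw [receivedLaw, map_apply (by fun_prop) ((by fun_prop : Measurable fun y => -s + y) hBm)]
        congr 1
        ext z
        simp
    _ = ∫⁻ r in Set.Ioi (0 : ℝ), ENNReal.ofReal (radialDensity n σ r) *
        ((S Set.univ)⁻¹ * ∫⁻ u, B.indicator 1 (r • (u : Vec n)) ∂S) := by
        rw [← lintegral_indicator_one hBm,
          lintegral_noiseLaw hn0 hσ (measurable_one.indicator hBm)]
    _ ≤ ∫⁻ r in Set.Ioi (0 : ℝ),
        ENNReal.ofReal (min (condUnionBound C s r) 1 * radialDensity n σ r) :=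
        setLIntegral_mono' measurableSet_Ioi hcap
    _ = _ := (ofReal_integral_eq_lintegral_ofReal hint (ae_of_all _ hnonneg)).symm

theorem unionBound_eq_average {n : ℕ} (C : Finset (Vec n)) (r : ℝ) :
    unionBound C r = ∑ s ∈ C, (1 / (C.card : ℝ)) * condUnionBound C s r := by
  classical
  have h : ∀ s ∈ C, condUnionBound C s r =
      ∑ δ ∈ distances C, (condSpectrum C s δ : ℝ) * pairError n r δ := by
    intro s hs
    rw [condUnionBound, ← Finset.sum_fiberwise_of_maps_to (g := fun t => dist s t)
      (t := distances C)]
    · refine Finset.sum_congr rfl fun δ hδ => ?_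
      have hδ0 : 0 < δ := by
        simp only [distances, Finset.mem_image, Finset.mem_offDiag] at hδ
        obtain ⟨p, hp, rfl⟩ := hδ
        exact dist_pos.2 hp.2.2
      have hset : (C.filter fun t => s ≠ t).filter (fun t => dist s t = δ) =
          C.filter fun t => dist s t = δ := by
        ext t
        simp only [Finset.mem_filter, and_assoc, and_congr_right_iff, and_iff_right_iff_imp]
        rintro _ h rfl
        simp [dist_self] at h
        exact hδ0.ne h
      rw [hset, Finset.sum_congr rfl (g := fun _ => pairError n r δ)
        fun t ht => by rw [(Finset.mem_filter.1 ht).2], Finset.sum_const, nsmul_eq_mul,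
        condSpectrum]
    · intro t ht
      rw [Finset.mem_filter] at ht
      simp only [distances, Finset.mem_image, Finset.mem_offDiag]
      exact ⟨(s, t), ⟨hs, ht.1, ht.2⟩, rfl⟩
  rw [unionBound, Finset.sum_congr (s₁ := C) rfl fun s hs => by rw [h s hs]]
  simp only [spectrum, Finset.sum_mul, Finset.mul_sum]
  rw [Finset.sum_comm]
  simp only [mul_assoc]

/-- Averaging the conditional bounds over the codewords; `min · 1` is concave. -/
theorem average_min_le {ι : Type*} (C : Finset ι) (hC : C.Nonempty) (U : ι → ℝ) :
    ∑ s ∈ C, (1 / (C.card : ℝ)) * min (U s) 1 ≤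
      min (∑ s ∈ C, (1 / (C.card : ℝ)) * U s) 1 := by
  have hc : (0 : ℝ) < C.card := Nat.cast_pos.2 hC.card_pos
  refine le_min ?_ ?_
  · exact Finset.sum_le_sum fun s _ => by gcongr; exact min_le_left _ _
  · calc ∑ s ∈ C, (1 / (C.card : ℝ)) * min (U s) 1 ≤ ∑ s ∈ C, (1 / (C.card : ℝ)) * 1 :=
        Finset.sum_le_sum fun s _ => by gcongr; exact min_le_right _ _
      _ = 1 := by
        rw [Finset.sum_const, nsmul_eq_mul]
        field_simp

theorem unionBound_nonneg {n : ℕ} (hn : 2 ≤ n) (C : Finset (Vec n)) (r : ℝ) :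
    0 ≤ unionBound C r := by
  rw [unionBound_eq_average]
  exact Finset.sum_nonneg fun s _ => mul_nonneg (by positivity) (condUnionBound_nonneg hn _ _ _)

theorem measurable_unionBound {n : ℕ} (C : Finset (Vec n)) : Measurable (unionBound C) := by
  unfold unionBound
  fun_prop

theorem errorProb_le_sphereBound {n : ℕ} (hn : 2 ≤ n) {σ : ℝ≥0} (hσ : 0 < σ) {C : Finset (Vec n)}
    (hC : C.Nonempty) {dec : Vec n → Vec n} (hdec : IsMLDecoder σ C dec) :
    errorProb σ C dec ≤ sphereBound σ C := by
  have hn0 : 0 < n := by omega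
  have hint := fun s => (integrable_min_one_mul_radialDensity hn0 hσ
    (measurable_condUnionBound C s) (condUnionBound_nonneg hn C s)).integrableOn (s := Set.Ioi 0)
  calc errorProb σ C dec
      ≤ ∑ s ∈ C, (1 / (C.card : ℝ)) *
        ∫ r in Set.Ioi (0 : ℝ), min (condUnionBound C s r) 1 * radialDensity n σ r :=
        Finset.sum_le_sum fun s hs => by gcongr; exact condErrorProb_le hn hσ hdec hs
    _ = ∫ r in Set.Ioi (0 : ℝ), ∑ s ∈ C, (1 / (C.card : ℝ)) *
        (min (condUnionBound C s r) 1 * radialDensity n σ r) := by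
        rw [integral_finsetSum _ fun s _ => (hint s).const_mul _]
        simp only [integral_const_mul]
    _ ≤ sphereBound σ C := by
        refine setIntegral_mono (integrable_finsetSum _ fun s _ => (hint s).const_mul _)
          (integrable_min_one_mul_radialDensity hn0 hσ (measurable_unionBound C)
            (unionBound_nonneg hn C)).integrableOn fun r => ?_
        simp only [← mul_assoc, ← Finset.sum_mul]
        rw [unionBound_eq_average]
        exact mul_le_mul_of_nonneg_right (average_min_le C hC _) (radialDensity_nonneg hn0 σ r)

/-- The spectrum determines the set of distances, as its support. -/
theorem mem_distances_iff {n : ℕ} (C : Finset (Vec n)) (δ : ℝ) :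
    δ ∈ distances C ↔ 0 < δ ∧ spectrum C δ ≠ 0 := by
  classical
  have hs : spectrum C δ ≠ 0 ↔ ∃ s ∈ C, ∃ t ∈ C, dist s t = δ := by
    rw [← not_iff_not, not_not, spectrum, Finset.sum_eq_zero_iff_of_nonneg fun _ _ => by positivity]
    push Not
    refine forall₂_congr fun s hs => ?_
    have : (C.card : ℝ) ≠ 0 := Nat.cast_ne_zero.2 (Finset.card_pos.2 ⟨s, hs⟩).ne'
    simp [this, condSpectrum, Finset.filter_eq_empty_iff]
  rw [hs]
  simp only [distances, Finset.mem_image, Finset.mem_offDiag, Prod.exists]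
  constructor
  · rintro ⟨s, t, ⟨hsC, htC, hst⟩, rfl⟩
    exact ⟨dist_pos.2 hst, s, hsC, t, htC, rfl⟩
  · rintro ⟨h0, s, hsC, t, htC, rfl⟩
    exact ⟨s, t, ⟨hsC, htC, dist_pos.1 h0⟩, rfl⟩

theorem unionBound_congr {n : ℕ} {C C' : Finset (Vec n)}
    (h : ∀ δ : ℝ, 0 < δ → spectrum C' δ = spectrum C δ) : unionBound C' = unionBound C := by
  have hd : distances C' = distances C := by
    ext δ
    rw [mem_distances_iff, mem_distances_iff]
    exact and_congr_right fun h0 => by rw [h δ h0]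
  ext r
  rw [unionBound, unionBound, hd]
  exact Finset.sum_congr rfl fun δ hδ => by rw [h δ ((mem_distances_iff C δ).1 hδ).1]

end SphereBound

theorem mainTheorem1 (n : ℕ) (hn : 2 ≤ n) (σ : ℝ≥0) (hσ : 0 < σ)
    (C : Finset (SphereBound.Vec n)) (hC : C.Nonempty) :
    -- the error probability of every maximum-likelihood decoder obeys the sphere bound
    (∀ dec : SphereBound.Vec n → SphereBound.Vec n, SphereBound.IsMLDecoder σ C dec →
      SphereBound.errorProb σ C dec ≤ SphereBound.sphereBound σ C) ∧
    -- the integral that defines the bound converges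
    IntegrableOn
      (fun r => min (SphereBound.unionBound C r) 1 * SphereBound.radialDensity n σ r)
      (Set.Ioi 0) ∧
    -- `g` is the density of `‖y - s‖` when `s` is transmitted
    (∀ s ∈ C, (SphereBound.receivedLaw σ s).map (fun y => ‖y - s‖) =
      volume.withDensity fun r => ENNReal.ofReal (SphereBound.radialDensity n σ r)) ∧
    -- `p₂` is the fraction of the sphere about `s` cut off by the bisector of `s` and `t`
    (∀ s ∈ C, ∀ t ∈ C, s ≠ t → ∀ r : ℝ, 0 < r →
      SphereBound.sphereFraction s t r = SphereBound.pairError n r (dist s t)) ∧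
    -- the bound depends on the code only through its Euclidean distance spectrum
    (∀ C' : Finset (SphereBound.Vec n), C'.Nonempty →
      (∀ δ : ℝ, 0 < δ → SphereBound.spectrum C' δ = SphereBound.spectrum C δ) →
      SphereBound.sphereBound σ C' = SphereBound.sphereBound σ C) := by
  have hn0 : 0 < n := by omega
  refine ⟨fun dec hdec => SphereBound.errorProb_le_sphereBound hn hσ hC hdec, ?_, ?_, ?_, ?_⟩
  · exact (SphereBound.integrable_min_one_mul_radialDensity hn0 hσ
      (SphereBound.measurable_unionBound C) (SphereBound.unionBound_nonneg hn C)).integrableOn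
  · exact fun s _ => SphereBound.map_norm_sub_receivedLaw hn0 hσ s
  · exact fun s _ t _ hst r hr => SphereBound.sphereFraction_eq_pairError hn hst hr
  · intro C' _ h
    rw [SphereBound.sphereBound, SphereBound.sphereBound, SphereBound.unionBound_congr h]
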